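/- **Proposition.** Let $E\subseteq B(H)$ and $F\subseteq B(K)$ be operator spaces, i.e. linear subspaces of the bounded operators on complex Hilbert spaces, with the matrix norms that $M_n(B(H))=B(H^{\oplus n})$ and $M_n(B(K))=B(K^{\oplus n})$ induce on $M_n(E)$ and $M_n(F)$. For every finite-rank linear map $T:E\to F$, $$\delta(T)\le \|T\|_{cb}\,\sqrt{\operatorname{rank} T}.$$ Here $\|T\|_{cb}=\sup_n\|\mathrm{id}_{M_n}\otimes T: M_n(E)\to M_n(F)\|\in[0,\infty]$, and $$\delta(T)=\inf\{\|v\|_{cb}\,\pi_{2,oh}(w)\}\in[0,\infty],$$ the infimum being over all sets $I$ and all factorizations $T=vw$ into linear maps $w:E\to OH(I)$, $v:OH(I)\to F$. The operator Hilbert space $OH(I)$ is $\ell^2(I)$ with the matrix norms $\|[x_{ij}]\|_{M_n(OH(I))}=\big\|[\langle x_{ij},x_{kl}\rangle]_{(i,k),(j,l)}\big\|_{M_{n^2}}^{1/2}$ (equivalently, $\|\sum_t a_t\otimes e_t\|=\|\sum_t a_t\otimes\overline{a_t}\|^{1/2}$ for the canonical basis $(e_t)$ and $a_t\in M_n$).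 For a linear map $w:E\to Y$ into a Banach space, $\pi_{2,oh}(w)\in[0,\infty]$ is the smallest constant $C$ such that $$\sum_i\|w(x_i)\|^2\le C^2\Big\|\sum_i x_i\otimes\overline{x_i}\Big\|_{E\otimes_{min}\overline E}$$ for all finite sequences $(x_i)$ in $E$, where $\overline E\subseteq B(\overline H)$ is the complex conjugate of $E$ and the norm on the right is that of $B(H\otimes_2\overline H)$. -/

import Mathlib

open scoped TensorProduct ENNReal NNReal ComplexConjugate

universe u v w

noncomputable section

/-! ### The conjugate Hilbert space and conjugate operators -/

/-- The complex conjugate `H̄` of a Hilbert space `H`: the same additive group with the same norm,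
the scalar `c` acting as `conj c`, and the inner product conjugated. -/
def ConjSpace (H : Type u) : Type u := H

namespace ConjSpace

variable {H : Type u} [NormedAddCommGroup H] [InnerProductSpace ℂ H]

instance : NormedAddCommGroup (ConjSpace H) := inferInstanceAs (NormedAddCommGroup H)

/-- The canonical (antilinear) identification `H → H̄`. -/
def of (x : H) : ConjSpace H := x

/-- The inverse of the canonical identification `H → H̄`. -/
def un (x : ConjSpace H) : H := x

instance : Module ℂ (ConjSpace H) where
  smul c x := of (conj c • un x)
  one_smul x := show conj (1 : ℂ) • un x = un x by simp
  mul_smul c d x := show conj (c * d) • un x = conj c • conj d • un x by simp [mul_smul]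
  smul_zero c := show conj c • (0 : H) = 0 by simp
  smul_add c x y := show conj c • (un x + un y) = conj c • un x + conj c • un y from smul_add _ _ _
  add_smul c d x := show conj (c + d) • un x = conj c • un x + conj d • un x by simp [add_smul]
  zero_smul x := show conj (0 : ℂ) • un x = 0 by simp

theorem un_smul (c : ℂ) (x : ConjSpace H) : un (c • x) = conj c • un x := rfl

instance : NormedSpace ℂ (ConjSpace H) where
  norm_smul_le c x := show ‖conj c • un x‖ ≤ ‖c‖ * ‖un x‖ by simp [norm_smul]

instance : InnerProductSpace ℂ (ConjSpace H) where
  inner x y := inner ℂ (un y) (un x)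
  norm_sq_eq_re_inner x := norm_sq_eq_re_inner (𝕜 := ℂ) (un x)
  conj_inner_symm x y := inner_conj_symm (𝕜 := ℂ) (un y) (un x)
  add_left x y z := inner_add_right (𝕜 := ℂ) (un z) (un x) (un y)
  smul_left x y c := inner_smul_right (𝕜 := ℂ) (un y) (un x) (conj c)

end ConjSpace

section OperatorSpaces

variable {H : Type u} [NormedAddCommGroup H] [InnerProductSpace ℂ H]
variable {K : Type v} [NormedAddCommGroup K] [InnerProductSpace ℂ K]

/-- The conjugate operator `x̄ : H̄ → H̄` of `x : H → H`, that is, `x̄ (ξ̄) = \overline{x ξ}`. -/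
def conjOp (x : H →L[ℂ] H) : ConjSpace H →L[ℂ] ConjSpace H :=
  LinearMap.mkContinuous
    { toFun := fun ξ => ConjSpace.of (x (ConjSpace.un ξ))
      map_add' := fun ξ η => x.map_add (ConjSpace.un ξ) (ConjSpace.un η)
      map_smul' := fun c ξ => x.map_smul (conj c) (ConjSpace.un ξ) }
    ‖x‖ (fun ξ => x.le_opNorm (ConjSpace.un ξ))

/-! ### Matrix norms, completely bounded norm, minimal tensor norm

An operator space is a linear subspace `E` of `B(H)`, `H` a complex Hilbert space, with the norms
that `M_n(B(H)) = B(H ⊕ ⋯ ⊕ H)` induces on `M_n(E)`. -/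

/-- The operator on the Hilbert sum `H ⊕ ⋯ ⊕ H` (`n` summands) given by an `n × n` matrix of
operators on `H`. -/
def matrixOp {n : ℕ} (x : Matrix (Fin n) (Fin n) (H →L[ℂ] H)) :
    PiLp 2 (fun _ : Fin n => H) →L[ℂ] PiLp 2 (fun _ : Fin n => H) :=
  (PiLp.continuousLinearEquiv 2 ℂ (fun _ : Fin n => H)).symm.toContinuousLinearMap ∘L
    ContinuousLinearMap.pi fun i => ∑ j, x i j ∘L PiLp.proj 2 (fun _ : Fin n => H) j

/-- The norm of `M_n(E)`, for an operator space `E ⊆ B(H)`. -/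
def opMatNorm (E : Submodule ℂ (H →L[ℂ] H)) (n : ℕ) (x : Matrix (Fin n) (Fin n) E) : ℝ :=
  ‖matrixOp (x.map fun e => (e : H →L[ℂ] H))‖

/-- The completely bounded norm, in `[0, ∞]`, of a linear map `T : V → W` between spaces whose
matrix norms on `M_n(V)` and `M_n(W)` are `p n` and `q n`: the supremum over all `n` of the norm of
`[x_ij] ↦ [T x_ij]`. -/
def cbNorm {V W : Type*} [AddCommGroup V] [Module ℂ V] [AddCommGroup W] [Module ℂ W]
    (p : ∀ n : ℕ, Matrix (Fin n) (Fin n) V → ℝ) (q : ∀ n : ℕ, Matrix (Fin n) (Fin n) W → ℝ)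
    (T : V →ₗ[ℂ] W) : ℝ≥0∞ :=
  ⨆ (n : ℕ) (x : Matrix (Fin n) (Fin n) V) (_ : p n x ≤ 1), ENNReal.ofReal (q n (x.map T))

/-- The norm of `∑ i, x i ⊗ y i` in the minimal tensor product of operator spaces in `B(H)` and
`B(K)`, that is, its norm as an operator on the Hilbert space tensor product of `H` and `K` (the
algebraic tensor product is dense there). -/
def minTensorNorm {n : ℕ} (x : Fin n → H →L[ℂ] H) (y : Fin n → K →L[ℂ] K) : ℝ :=
  ‖∑ i, TensorProduct.mapL (x i) (y i)‖

/-! ### The operator Hilbert space -/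

/-- The Hilbert space `ℓ²(I)` underlying the operator Hilbert space `OH(I)`. -/
abbrev OH (I : Type w) : Type w := lp (fun _ : I => ℂ) 2

/-- The norm of `M_n(OH(I))`. If `x = ∑ t, a_t ⊗ e_t` with `a_t ∈ M_n` and `(e_t)` the canonical
basis, then `‖x‖ = ‖∑ t, a_t ⊗ conj a_t‖^{1/2}`, the norm on the right being that of operators on
`ℂⁿ ⊗ ℂⁿ`; the entry of `∑ t, a_t ⊗ conj a_t` at `((i, k), (j, l))` is
`∑ t, (a_t)_{ij} * conj (a_t)_{kl} = ⟪x_{kl}, x_{ij}⟫`. -/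
def ohMatNorm (I : Type w) (n : ℕ) (x : Matrix (Fin n) (Fin n) (OH I)) : ℝ :=
  √‖Matrix.toEuclideanCLM (n := Fin n × Fin n) (𝕜 := ℂ)
    (Matrix.of fun a b => inner ℂ (x a.2 b.2) (x a.1 b.1))‖

/-! ### The `(2, oh)`-summing norm and `δ` -/

/-- The `(2, oh)`-summing norm of `u : E → Y`, in `[0, ∞]`: the smallest constant `C` such that
`∑ ‖u (x_i)‖² ≤ C² ‖∑ x_i ⊗ x̄_i‖` in `E ⊗_min Ē` for all finite sequences in `E`, and `∞` if there
is none. -/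
def pi2oh (E : Submodule ℂ (H →L[ℂ] H)) {Y : Type*} [NormedAddCommGroup Y] [NormedSpace ℂ Y]
    (u : E →ₗ[ℂ] Y) : ℝ≥0∞ :=
  ⨅ (C : ℝ≥0) (_ : ∀ (n : ℕ) (x : Fin n → E),
    ∑ i, ‖u (x i)‖ ^ 2 ≤ (C : ℝ) ^ 2 *
      minTensorNorm (fun i => (x i : H →L[ℂ] H)) (fun i => conjOp (x i : H →L[ℂ] H))),
    (C : ℝ≥0∞)

/-- `δ(T)`: the infimum of `‖v‖_cb π_{2,oh}(w)` over all factorizations `T = v w` through an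
operator Hilbert space `OH(I)`. The index sets `I` range over an arbitrary universe. -/
def delta (E : Submodule ℂ (H →L[ℂ] H)) (F : Submodule ℂ (K →L[ℂ] K)) (T : E →ₗ[ℂ] F) : ℝ≥0∞ :=
  ⨅ (I : Type w) (a : E →ₗ[ℂ] OH I) (b : OH I →ₗ[ℂ] F) (_ : b ∘ₗ a = T),
    cbNorm (ohMatNorm I) (opMatNorm F) b * pi2oh E a

end OperatorSpaces

end

/-! Let G be the range of T and n its dimension. Everything reduces to finding a basis x of G with
‖∑ x_t ⊗ x̄_t‖ ≤ 1 whose coordinate map G → OH_n has π_{2,oh} at most √n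
(`exists_basis_coord_sum_le`). Then T = v w, where w is T followed by the coordinates and v sends
e_t to x_t. Haagerup's Cauchy-Schwarz inequality (`norm_matrixOp_sum_smul_le`) gives ‖v‖_cb ≤ 1, and
`minTensorNorm_map_conj_le` gives π_{2,oh}(w) ≤ ‖T‖_cb √n.

The basis comes from a determinant maximization in the style of John and Lewis. Relative to a fixed
basis g, put x_t = ∑ A_{ts} g_s; then ∑ x_t ⊗ x̄_t = Φ(A*A) for a linear injective Φ (`tensorForm`).
Take A maximizing |det A| subject to ‖Φ(A*A)‖ ≤ 1. Replacing A*A by A*(1 + εQ)A with Q ≥ 0 gives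
det(1 + εQ) ≤ (1 + ε‖Φ(A*QA)‖)^n, and the first-order terms at ε = 0 give tr Q ≤ n‖Φ(A*QA)‖
(`exists_trace_le`). For Q = c*c, with c the matrix of coordinates of a finite sequence in G, this
is the summing inequality. -/

theorem ContinuousLinearMap.opNorm_le_of_norm_inner_le {V : Type*} [NormedAddCommGroup V]
    [InnerProductSpace ℂ V] (S : V →L[ℂ] V) {C : ℝ} (hC : 0 ≤ C)
    (h : ∀ x y, ‖inner ℂ y (S x)‖ ≤ C * ‖y‖ * ‖x‖) : ‖S‖ ≤ C := by
  refine S.opNorm_le_bound hC fun x => ?_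
  have h1 := h x (S x)
  rw [inner_self_eq_norm_sq_to_K] at h1
  rcases (norm_nonneg (S x)).eq_or_lt with h0 | h0
  · rw [← h0]; positivity
  · refine le_of_mul_le_mul_left ?_ h0
    simp only [norm_pow, RCLike.norm_ofReal, abs_norm] at h1
    linarith

/-! ### Minimal tensor norms and completely bounded maps. -/

section

variable {H : Type u} [NormedAddCommGroup H] [InnerProductSpace ℂ H]
variable {K : Type v} [NormedAddCommGroup K] [InnerProductSpace ℂ K]

theorem ConjSpace.inner_of_conjOp (x : H →L[ℂ] H) (ξ η : ConjSpace H) :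
    inner ℂ η (conjOp x ξ) = conj (inner ℂ (ConjSpace.un η) (x (ConjSpace.un ξ))) :=
  (inner_conj_symm (𝕜 := ℂ) (x (ConjSpace.un ξ)) (ConjSpace.un η)).symm

theorem ConjSpace.inner_eq_conj (ξ η : ConjSpace H) :
    inner ℂ η ξ = conj (inner ℂ (ConjSpace.un η) (ConjSpace.un ξ)) :=
  (inner_conj_symm (𝕜 := ℂ) (ConjSpace.un ξ) (ConjSpace.un η)).symm

theorem conjOp_add (x y : H →L[ℂ] H) : conjOp (x + y) = conjOp x + conjOp y := rfl

theorem conjOp_smul (c : ℂ) (x : H →L[ℂ] H) : conjOp (c • x) = conj c • conjOp x := by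
  ext ξ
  change ConjSpace.of (c • x (ConjSpace.un ξ)) = ConjSpace.of (conj (conj c) • x (ConjSpace.un ξ))
  simp

/-- Two vectors of a tensor product can be expanded along a common finite orthonormal family of the
second factor. -/
theorem exists_orthonormal_expansion (ζ ζ' : H ⊗[ℂ] K) :
    ∃ (m : ℕ) (f : Fin m → K) (ξ ξ' : Fin m → H), Orthonormal ℂ f ∧
      ζ = ∑ j, ξ j ⊗ₜ f j ∧ ζ' = ∑ j, ξ' j ⊗ₜ f j := by
  obtain ⟨H', K', iH, iK, hz⟩ :=
    TensorProduct.exists_finite_submodule_of_setFinite {ζ, ζ'} (Set.toFinite _)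
  have := iK
  let f := stdOrthonormalBasis ℂ K'
  have key : ∀ y : H' ⊗[ℂ] K', ∃ ξ : Fin (Module.finrank ℂ K') → H,
      TensorProduct.mapIncl H' K' y = ∑ j, ξ j ⊗ₜ (f j : K) := by
    intro y
    induction y using TensorProduct.induction_on with
    | zero => exact ⟨0, by simp⟩
    | tmul a b =>
      refine ⟨fun j => f.repr b j • (a : H), ?_⟩
      conv_lhs => rw [← f.sum_repr b]
      simp [TensorProduct.tmul_sum, TensorProduct.smul_tmul]
    | add y z hy hz =>
      obtain ⟨ξ, h1⟩ := hy
      obtain ⟨ξ', h2⟩ := hz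
      exact ⟨ξ + ξ', by simp [h1, h2, TensorProduct.add_tmul, Finset.sum_add_distrib]⟩
  obtain ⟨y, hy⟩ := hz (Set.mem_insert _ _)
  obtain ⟨y', hy'⟩ := hz (Set.mem_insert_of_mem _ rfl)
  obtain ⟨ξ, h1⟩ := key y
  obtain ⟨ξ', h2⟩ := key y'
  refine ⟨_, fun j => (f j : K), ξ, ξ', ?_, hy ▸ h1, hy' ▸ h2⟩
  exact f.orthonormal.comp_linearIsometry K'.subtypeₗᵢ

theorem norm_sq_sum_tmul_orthonormal {m : ℕ} {f : Fin m → K} (hf : Orthonormal ℂ f)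
    (ξ : Fin m → H) : ‖∑ j, ξ j ⊗ₜ[ℂ] f j‖ ^ 2 = ∑ j, ‖ξ j‖ ^ 2 := by
  have : inner ℂ (∑ j, ξ j ⊗ₜ[ℂ] f j) (∑ j, ξ j ⊗ₜ[ℂ] f j) = ((∑ j, ‖ξ j‖ ^ 2 : ℝ) : ℂ) := by
    simp [sum_inner, inner_sum, orthonormal_iff_ite.mp hf, inner_self_eq_norm_sq_to_K]
  have h := (inner_self_eq_norm_sq_to_K (𝕜 := ℂ) (∑ j, ξ j ⊗ₜ[ℂ] f j)).symm.trans this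
  rw [← RCLike.ofReal_pow] at h
  exact RCLike.ofReal_injective h

theorem inner_sum_mapL {n l m : ℕ} (x : Fin n → H →L[ℂ] H) (b : Fin n → K →L[ℂ] K)
    (ξ : Fin m → H) (f : Fin m → K) (ξ' : Fin l → H) (f' : Fin l → K) :
    inner ℂ (∑ i, ξ' i ⊗ₜ[ℂ] f' i) ((∑ p, TensorProduct.mapL (x p) (b p)) (∑ j, ξ j ⊗ₜ[ℂ] f j)) =
      ∑ i, ∑ j, ∑ p, inner ℂ (ξ' i) (x p (ξ j)) * inner ℂ (f' i) (b p (f j)) := by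
  simp only [sum_apply, sum_inner, inner_sum, map_sum,
    TensorProduct.mapL_tmul, TensorProduct.inner_tmul]
  conv_rhs => rw [Finset.sum_comm]
  exact Finset.sum_congr rfl fun j _ => Finset.sum_comm

theorem inner_matrixOp {m : ℕ} (X : Matrix (Fin m) (Fin m) (H →L[ℂ] H))
    (ξ η : PiLp 2 (fun _ : Fin m => H)) :
    inner ℂ η (matrixOp X ξ) = ∑ i, ∑ j, inner ℂ (η i) (X i j (ξ j)) := by
  simp [matrixOp, PiLp.inner_apply, inner_sum]

theorem norm_matrixOp_le {m : ℕ} (X : Matrix (Fin m) (Fin m) (H →L[ℂ] H)) {C : ℝ} (hC : 0 ≤ C)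
    (h : ∀ ξ η : Fin m → H, ‖∑ i, ∑ j, inner ℂ (η i) (X i j (ξ j))‖ ≤
      C * √(∑ i, ‖η i‖ ^ 2) * √(∑ j, ‖ξ j‖ ^ 2)) : ‖matrixOp X‖ ≤ C := by
  refine ContinuousLinearMap.opNorm_le_of_norm_inner_le _ hC fun ξ η => ?_
  rw [inner_matrixOp, PiLp.norm_eq_of_L2, PiLp.norm_eq_of_L2]
  exact h _ _

theorem norm_sum_inner_le {m : ℕ} (X : Matrix (Fin m) (Fin m) (H →L[ℂ] H)) (ξ η : Fin m → H) :
    ‖∑ i, ∑ j, inner ℂ (η i) (X i j (ξ j))‖ ≤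
      ‖matrixOp X‖ * √(∑ i, ‖η i‖ ^ 2) * √(∑ j, ‖ξ j‖ ^ 2) := by
  have h := inner_matrixOp X (WithLp.toLp 2 ξ) (WithLp.toLp 2 η)
  have h1 := norm_inner_le_norm (𝕜 := ℂ) (WithLp.toLp 2 η) (matrixOp X (WithLp.toLp 2 ξ))
  have h2 := (matrixOp X).le_opNorm (WithLp.toLp 2 ξ)
  rw [h] at h1
  have e1 : ‖WithLp.toLp 2 ξ‖ = √(∑ j, ‖ξ j‖ ^ 2) := PiLp.norm_eq_of_L2 _
  have e2 : ‖WithLp.toLp 2 η‖ = √(∑ j, ‖η j‖ ^ 2) := PiLp.norm_eq_of_L2 _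
  rw [e1] at h2
  rw [e2] at h1
  calc _ ≤ _ := h1
    _ ≤ _ := mul_le_mul_of_nonneg_left h2 (Real.sqrt_nonneg _)
    _ = _ := by ring

theorem minTensorNorm_nonneg {n : ℕ} (x : Fin n → H →L[ℂ] H) (b : Fin n → K →L[ℂ] K) :
    0 ≤ minTensorNorm x b := by
  unfold minTensorNorm
  exact norm_nonneg (∑ i, TensorProduct.mapL (x i) (b i))

/-- Compressing the second tensor factor to the span of an orthonormal family. -/
theorem norm_matrixOp_compression_le {n m : ℕ} (x : Fin n → H →L[ℂ] H) (b : Fin n → K →L[ℂ] K)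
    {f : Fin m → K} (hf : Orthonormal ℂ f) :
    ‖matrixOp (Matrix.of fun i j => ∑ p, (inner ℂ (f i) (b p (f j)) : ℂ) • x p)‖ ≤
      minTensorNorm x b := by
  refine norm_matrixOp_le _ (minTensorNorm_nonneg _ _) fun ξ η => ?_
  have h1 := norm_inner_le_norm (𝕜 := ℂ) (∑ i, η i ⊗ₜ[ℂ] f i)
    ((∑ p, TensorProduct.mapL (x p) (b p)) (∑ j, ξ j ⊗ₜ[ℂ] f j))
  have h2 := (∑ p, TensorProduct.mapL (x p) (b p)).le_opNorm (∑ j, ξ j ⊗ₜ[ℂ] f j)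
  rw [inner_sum_mapL] at h1
  have e : ∀ ξ : Fin m → H, ‖∑ j, ξ j ⊗ₜ[ℂ] f j‖ = √(∑ j, ‖ξ j‖ ^ 2) := fun ξ => by
    rw [← norm_sq_sum_tmul_orthonormal hf, Real.sqrt_sq (norm_nonneg _)]
  rw [e] at h1 h2
  calc _ = ‖∑ i, ∑ j, ∑ p, inner ℂ (η i) (x p (ξ j)) * inner ℂ (f i) (b p (f j))‖ := by
        simp [sum_apply, mul_comm]
    _ ≤ _ := h1
    _ ≤ _ := mul_le_mul_of_nonneg_left h2 (Real.sqrt_nonneg _)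
    _ = _ := by rw [minTensorNorm]; ring

/-- Two vectors of K ⊗ L involve only finitely many orthonormal vectors f of L. Between them, the
operator has the matrix coefficients of an m × m matrix over F, the image under T of the
corresponding compression to f over E. So the bound on matrices applies, and compressing does not
increase the norm. -/
theorem minTensorNorm_map_left_le {L : Type*} [NormedAddCommGroup L] [InnerProductSpace ℂ L]
    {E : Submodule ℂ (H →L[ℂ] H)} {F : Submodule ℂ (K →L[ℂ] K)} (T : E →ₗ[ℂ] F) {c : ℝ}
    (hc : 0 ≤ c) (hT : ∀ m (X : Matrix (Fin m) (Fin m) E),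
      opMatNorm F m (X.map T) ≤ c * opMatNorm E m X)
    {n : ℕ} (x : Fin n → E) (b : Fin n → L →L[ℂ] L) :
    minTensorNorm (fun i => (T (x i) : K →L[ℂ] K)) b ≤
      c * minTensorNorm (fun i => (x i : H →L[ℂ] H)) b := by
  refine ContinuousLinearMap.opNorm_le_of_norm_inner_le _
    (mul_nonneg hc (minTensorNorm_nonneg _ _)) fun ζ ζ' => ?_
  obtain ⟨m, f, ξ, ξ', hf, rfl, rfl⟩ := exists_orthonormal_expansion ζ ζ'
  have e : ∀ ξ : Fin m → K, ‖∑ j, ξ j ⊗ₜ[ℂ] f j‖ = √(∑ j, ‖ξ j‖ ^ 2) := fun ξ => by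
    rw [← norm_sq_sum_tmul_orthonormal hf, Real.sqrt_sq (norm_nonneg _)]
  rw [inner_sum_mapL, e, e]
  let X : Matrix (Fin m) (Fin m) E :=
    Matrix.of fun i j => ∑ p, (inner ℂ (f i) (b p (f j)) : ℂ) • x p
  have h1 := norm_sum_inner_le ((X.map T).map fun e => (e : K →L[ℂ] K)) ξ ξ'
  have h2 : opMatNorm E m X ≤ minTensorNorm (fun i => (x i : H →L[ℂ] H)) b := by
    refine le_trans (le_of_eq ?_) (norm_matrixOp_compression_le (fun i => (x i : H →L[ℂ] H)) b hf)
    rw [opMatNorm]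
    congr 2
    ext i j : 1
    simp [X]
  have h3 := (hT m X).trans (mul_le_mul_of_nonneg_left h2 hc)
  calc _ = ‖∑ i, ∑ j, inner ℂ (ξ' i) (((X.map T).map fun e => (e : K →L[ℂ] K)) i j (ξ j))‖ := by
        simp [X, mul_comm]
    _ ≤ _ := h1
    _ ≤ _ := by gcongr; exact h3

/-- The antiunitary flip ξ ⊗ η̄ ↦ η ⊗ ξ̄ carries one operator to the other. This moves the
conjugated leg to the left, where T can be applied to it. -/
theorem minTensorNorm_conjOp_swap_le {n : ℕ} (x : Fin n → H →L[ℂ] H) (y : Fin n → K →L[ℂ] K) :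
    minTensorNorm y (fun i => conjOp (x i)) ≤ minTensorNorm x (fun i => conjOp (y i)) := by
  refine ContinuousLinearMap.opNorm_le_of_norm_inner_le _ (minTensorNorm_nonneg _ _) fun ζ ζ' => ?_
  obtain ⟨m, f, ξ, ξ', hf, rfl, rfl⟩ := exists_orthonormal_expansion ζ ζ'
  have e : ∀ ξ : Fin m → K, ‖∑ j, ξ j ⊗ₜ[ℂ] f j‖ =
      ‖∑ j, ConjSpace.un (f j) ⊗ₜ[ℂ] ConjSpace.of (ξ j)‖ := fun ξ => by
    rw [norm_eq_sqrt_re_inner (𝕜 := ℂ), norm_eq_sqrt_re_inner (𝕜 := ℂ)]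
    congr 1
    rw [← RCLike.conj_re]
    congr 1
    simp only [sum_inner, inner_sum, TensorProduct.inner_tmul, map_sum, map_mul,
      ConjSpace.inner_eq_conj]
    simp [mul_comm, ConjSpace.un, ConjSpace.of]
  have h1 := norm_inner_le_norm (𝕜 := ℂ) (∑ j, ConjSpace.un (f j) ⊗ₜ[ℂ] ConjSpace.of (ξ' j))
    ((∑ p, TensorProduct.mapL (x p) (conjOp (y p)))
      (∑ j, ConjSpace.un (f j) ⊗ₜ[ℂ] ConjSpace.of (ξ j)))
  have h2 := (∑ p, TensorProduct.mapL (x p) (conjOp (y p))).le_opNorm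
    (∑ j, ConjSpace.un (f j) ⊗ₜ[ℂ] ConjSpace.of (ξ j))
  rw [inner_sum_mapL, ← e] at h1
  rw [← e] at h2
  rw [inner_sum_mapL]
  calc _ = _ := by
        rw [← RCLike.norm_conj]
        congr 1
        simp only [map_sum, map_mul, ConjSpace.inner_of_conjOp, Complex.conj_conj]
        simp [mul_comm, ConjSpace.un, ConjSpace.of]
    _ ≤ _ := h1
    _ ≤ _ := mul_le_mul_of_nonneg_left h2 (norm_nonneg _)
    _ = _ := by rw [minTensorNorm]; ring

/-- A completely bounded map `T` satisfies `‖T ⊗ T̄‖ ≤ ‖T‖_cb²` on the tensors `∑ x_i ⊗ x̄_i`. -/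
theorem minTensorNorm_map_conj_le
    {E : Submodule ℂ (H →L[ℂ] H)} {F : Submodule ℂ (K →L[ℂ] K)} (T : E →ₗ[ℂ] F) {c : ℝ}
    (hc : 0 ≤ c) (hT : ∀ m (X : Matrix (Fin m) (Fin m) E),
      opMatNorm F m (X.map T) ≤ c * opMatNorm E m X)
    {n : ℕ} (x : Fin n → E) :
    minTensorNorm (fun i => (T (x i) : K →L[ℂ] K)) (fun i => conjOp (T (x i) : K →L[ℂ] K)) ≤
      c ^ 2 * minTensorNorm (fun i => (x i : H →L[ℂ] H)) (fun i => conjOp (x i : H →L[ℂ] H)) := by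
  have h1 := minTensorNorm_map_left_le T hc hT x (fun i => conjOp (T (x i) : K →L[ℂ] K))
  have h2 := minTensorNorm_conjOp_swap_le (fun i => (T (x i) : K →L[ℂ] K))
    (fun i => (x i : H →L[ℂ] H))
  have h3 := minTensorNorm_map_left_le T hc hT x (fun i => conjOp (x i : H →L[ℂ] H))
  calc _ ≤ _ := h1
    _ ≤ c * (c * minTensorNorm (fun i => (x i : H →L[ℂ] H))
        (fun i => conjOp (x i : H →L[ℂ] H))) := by gcongr; exact h2.trans h3
    _ = _ := by ring

end

/-! ### Haagerup's Cauchy-Schwarz inequality. -/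

section

variable {V : Type*} [NormedAddCommGroup V] [InnerProductSpace ℂ V]
variable {K : Type v} [NormedAddCommGroup K] [InnerProductSpace ℂ K]

theorem norm_sum_smul_le_of_orthogonal {ι : Type*} [Fintype ι] {p : ι → V}
    (hp : Pairwise fun k l => inner ℂ (p k) (p l) = 0) (hp1 : ∀ k, ‖p k‖ ≤ 1) (s : ι → ℝ) :
    ‖∑ k, (s k : ℂ) • p k‖ ≤ √(∑ k, s k ^ 2) := by
  classical
  refine Real.le_sqrt_of_sq_le ?_
  have h : inner ℂ (∑ k, (s k : ℂ) • p k) (∑ k, (s k : ℂ) • p k) =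
      ((∑ k, s k ^ 2 * ‖p k‖ ^ 2 : ℝ) : ℂ) := by
    rw [sum_inner, Complex.ofReal_sum]
    refine Finset.sum_congr rfl fun k _ => ?_
    rw [inner_sum, Finset.sum_eq_single k]
    · rw [inner_smul_left, inner_smul_right, inner_self_eq_norm_sq_to_K]
      simp
      ring
    · intro l _ hl
      rw [inner_smul_left, inner_smul_right, hp hl.symm]
      simp
    · simp
  rw [inner_self_eq_norm_sq_to_K, ← RCLike.ofReal_pow] at h
  rw [RCLike.ofReal_injective h]
  refine Finset.sum_le_sum fun k _ => mul_le_of_le_one_right (sq_nonneg _) ?_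
  exact pow_le_one₀ (norm_nonneg _) (hp1 k)

/-- The double sum is a single matrix coefficient of M, between ∑ r_l q_l and ∑ s_k p_k. It serves
for p_k = b_k ⊗ b̄_k built from singular vectors, for which the weights s_k have the ℓ² norm of the
original vector. -/
theorem sum_mul_le_opNorm_of_orthogonal {ι κ : Type*} [Fintype ι] [Fintype κ] (M : V →L[ℂ] V)
    {p : ι → V} (hp : Pairwise fun k l => inner ℂ (p k) (p l) = 0) (hp1 : ∀ k, ‖p k‖ ≤ 1)
    {q : κ → V} (hq : Pairwise fun k l => inner ℂ (q k) (q l) = 0) (hq1 : ∀ k, ‖q k‖ ≤ 1)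
    (s : ι → ℝ) (r : κ → ℝ) (β : κ → ι → ℝ) (hβ : ∀ l k, inner ℂ (q l) (M (p k)) = (β l k : ℂ)) :
    ∑ l, ∑ k, r l * s k * β l k ≤ ‖M‖ * (√(∑ l, r l ^ 2) * √(∑ k, s k ^ 2)) := by
  have h : inner ℂ (∑ l, (r l : ℂ) • q l) (M (∑ k, (s k : ℂ) • p k)) =
      ((∑ l, ∑ k, r l * s k * β l k : ℝ) : ℂ) := by
    simp only [map_sum, map_smul, sum_inner, inner_sum, inner_smul_left, inner_smul_right, hβ,
      Complex.ofReal_sum, Complex.ofReal_mul, Complex.conj_ofReal]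
    simp only [Finset.mul_sum]
    rw [Finset.sum_comm]
    exact Finset.sum_congr rfl fun l _ => Finset.sum_congr rfl fun k _ => by ring
  have h1 := norm_inner_le_norm (𝕜 := ℂ) (∑ l, (r l : ℂ) • q l) (M (∑ k, (s k : ℂ) • p k))
  rw [h, Complex.norm_real, Real.norm_eq_abs] at h1
  calc _ ≤ _ := (le_abs_self _).trans h1
    _ ≤ √(∑ l, r l ^ 2) * (‖M‖ * √(∑ k, s k ^ 2)) := by
        gcongr
        · exact norm_sum_smul_le_of_orthogonal hq hq1 r
        · exact M.le_opNorm_of_le (norm_sum_smul_le_of_orthogonal hp hp1 s)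
    _ = _ := by ring

/-- The singular value decomposition of a tuple of vectors in a Hilbert space. -/
theorem exists_svd_tuple {m : ℕ} (ξ : Fin m → V) :
    ∃ (s : Fin m → ℝ) (b : Fin m → Fin m → ℂ) (e : Fin m → V), (∀ k, 0 ≤ s k) ∧
      (∀ k l, ∑ j, conj (b k j) * b l j = if k = l then 1 else 0) ∧
      (Pairwise fun k l => inner ℂ (e k) (e l) = 0) ∧ (∀ k, ‖e k‖ ≤ 1) ∧
      ∑ k, s k ^ 2 = ∑ j, ‖ξ j‖ ^ 2 ∧ ∀ j, ξ j = ∑ k, ((s k : ℂ) * b k j) • e k := by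
  classical
  have hG : (Matrix.gram ℂ ξ).IsHermitian := Matrix.isHermitian_gram ℂ ξ
  let v := hG.eigenvectorBasis
  let ω : Fin m → V := fun k => ∑ j, v k j • ξ j
  -- The ω k combine the ξ j along eigenvectors of their Gram matrix, hence are mutually orthogonal;
  -- their norms are the singular values.
  have hv : ∀ k l, ∑ j, conj (v k j) * v l j = if k = l then (1 : ℂ) else 0 := fun k l => by
    rw [← orthonormal_iff_ite.mp v.orthonormal k l, PiLp.inner_apply]
    simp [mul_comm]
  have hv' : ∀ i j, ∑ k, conj (v k i) * v k j = if i = j then (1 : ℂ) else 0 := fun i j => by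
    let U : Matrix (Fin m) (Fin m) ℂ := Matrix.of fun k j => v k j
    have h : (U.map conj) * U.transpose = 1 := by
      ext k l
      simpa [U, Matrix.mul_apply, Matrix.one_apply] using hv k l
    have h' := congrFun (congrFun (show U.transpose * U.map conj = 1 from
      mul_eq_one_comm.mp h) j) i
    simpa [U, Matrix.mul_apply, Matrix.one_apply, mul_comm, eq_comm] using h'
  have hω : ∀ k l, inner ℂ (ω k) (ω l) = (hG.eigenvalues l : ℂ) * if k = l then (1 : ℂ) else 0 := by
    intro k l
    have h := hG.mulVec_eigenvectorBasis l
    calc inner ℂ (ω k) (ω l) = ∑ i, conj (v k i) * ((Matrix.gram ℂ ξ).mulVec (v l).ofLp) i := by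
          simp only [ω, sum_inner, inner_sum, inner_smul_left, inner_smul_right, Matrix.mulVec,
            dotProduct, Matrix.gram_apply, Finset.mul_sum]
          rw [Finset.sum_comm]
          exact Finset.sum_congr rfl fun i _ => Finset.sum_congr rfl fun j _ => by ring
      _ = ∑ i, conj (v k i) * ((hG.eigenvalues l : ℂ) * v l i) := by
          rw [h]; rfl
      _ = _ := by rw [← hv, Finset.mul_sum]; exact Finset.sum_congr rfl fun i _ => by ring
  have hξ : ∀ j, ξ j = ∑ k, conj (v k j) • ω k := by
    intro j
    simp only [ω, Finset.smul_sum, smul_smul]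
    rw [Finset.sum_comm]
    simp [← Finset.sum_smul, hv']
  -- When ω k = 0 the convention 0⁻¹ = 0 makes the normalized vector zero, so the left vectors
  -- satisfy only ‖e k‖ ≤ 1.
  refine ⟨fun k => ‖ω k‖, fun k j => conj (v k j), fun k => ((‖ω k‖⁻¹ : ℝ) : ℂ) • ω k,
    fun k => norm_nonneg _, fun k l => ?_, fun k l hkl => ?_, fun k => ?_, ?_, fun j => ?_⟩
  · have := congrArg conj (hv k l)
    simpa [apply_ite] using this
  · simp [hω, if_neg hkl]
  · rw [norm_smul, Complex.norm_real, norm_inv, norm_norm]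
    exact inv_mul_le_one
  · have h : ((∑ k, ‖ω k‖ ^ 2 : ℝ) : ℂ) = ((∑ j, ‖ξ j‖ ^ 2 : ℝ) : ℂ) := by
      calc ((∑ k, ‖ω k‖ ^ 2 : ℝ) : ℂ) = ∑ k, inner ℂ (ω k) (ω k) := by
            simp [inner_self_eq_norm_sq_to_K]
        _ = ∑ k, ∑ i, ∑ j, conj (v k i) * v k j * inner ℂ (ξ i) (ξ j) := by
            simp only [ω, sum_inner, inner_sum, inner_smul_left, inner_smul_right, mul_assoc,
              Finset.mul_sum]
            refine Finset.sum_congr rfl fun k _ => ?_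
            rw [Finset.sum_comm]
            exact Finset.sum_congr rfl fun i _ => Finset.sum_congr rfl fun j _ => by ring
        _ = ∑ i, ∑ j, (∑ k, conj (v k i) * v k j) * inner ℂ (ξ i) (ξ j) := by
            simp only [Finset.sum_mul]
            rw [Finset.sum_comm]
            exact Finset.sum_congr rfl fun i _ => Finset.sum_comm
        _ = _ := by simp [hv', inner_self_eq_norm_sq_to_K]
    exact_mod_cast h
  · conv_lhs => rw [hξ j]
    refine Finset.sum_congr rfl fun k _ => ?_
    rcases eq_or_ne (ω k) 0 with h0 | h0
    · simp [h0]
    · rw [smul_smul]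
      congr 1
      have : (‖ω k‖ : ℂ) ≠ 0 := by simpa using h0
      push_cast
      field_simp

/-- On the vectors a ⊗ ā and b ⊗ b̄ each term A_t ⊗ Ā_t contributes z z̄ with z = ⟨a, A_t b⟩, so the
coefficient is a sum of squares. -/
theorem inner_toEuclideanCLM_toLp_mul_conj {n m : ℕ} (A : Fin n → Matrix (Fin m) (Fin m) ℂ)
    (a b : Fin m → ℂ) :
    inner ℂ (WithLp.toLp 2 fun q : Fin m × Fin m => a q.1 * conj (a q.2))
      (Matrix.toEuclideanCLM (n := Fin m × Fin m) (𝕜 := ℂ)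
        (Matrix.of fun p q => ∑ t, A t p.1 q.1 * conj (A t p.2 q.2))
        (WithLp.toLp 2 fun q : Fin m × Fin m => b q.1 * conj (b q.2))) =
      ((∑ t, ‖∑ i, ∑ j, A t i j * conj (a i) * b j‖ ^ 2 : ℝ) : ℂ) := by
  rw [Matrix.toEuclideanCLM_toLp, EuclideanSpace.inner_toLp_toLp]
  have h : ∀ t, ((‖∑ i, ∑ j, A t i j * conj (a i) * b j‖ ^ 2 : ℝ) : ℂ) =
      ∑ p : Fin m × Fin m, ∑ q : Fin m × Fin m, (A t p.1 q.1 * conj (a p.1) * b q.1) *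
        conj (A t p.2 q.2 * conj (a p.2) * b q.2) := fun t => by
    rw [Complex.ofReal_pow, ← Complex.mul_conj', map_sum, Finset.sum_mul_sum,
      Fintype.sum_prod_type]
    simp only [map_sum, Finset.sum_mul_sum, Fintype.sum_prod_type]
  rw [Complex.ofReal_sum, Finset.sum_congr rfl fun t _ => h t, Finset.sum_comm]
  simp only [dotProduct, Matrix.mulVec, Matrix.of_apply, Pi.star_apply, Finset.sum_mul]
  refine Finset.sum_congr rfl fun p _ => ?_
  rw [Finset.sum_comm]
  refine Finset.sum_congr rfl fun q _ => Finset.sum_congr rfl fun t _ => ?_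
  simp
  ring

theorem inner_toLp_mul_conj {m : ℕ} (a b : Fin m → ℂ) :
    inner ℂ (WithLp.toLp 2 fun q : Fin m × Fin m => a q.1 * conj (a q.2))
      (WithLp.toLp 2 fun q : Fin m × Fin m => b q.1 * conj (b q.2)) =
      ((‖∑ i, conj (a i) * b i‖ ^ 2 : ℝ) : ℂ) := by
  rw [EuclideanSpace.inner_toLp_toLp, Complex.ofReal_pow, ← Complex.mul_conj', map_sum,
    Finset.sum_mul_sum, ← Fintype.sum_prod_type']
  refine Finset.sum_congr rfl fun p _ => ?_
  simp
  ring

/-- The Cauchy-Schwarz inequality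
`‖∑ a_t ⊗ x_t‖ ≤ ‖∑ a_t ⊗ ā_t‖^{1/2} ‖∑ x_t ⊗ x̄_t‖^{1/2}` of Haagerup. -/
theorem norm_matrixOp_sum_smul_le {n m : ℕ} (A : Fin n → Matrix (Fin m) (Fin m) ℂ)
    (x : Fin n → K →L[ℂ] K) :
    ‖matrixOp (Matrix.of fun i j => ∑ t, A t i j • x t)‖ ≤
      √‖Matrix.toEuclideanCLM (n := Fin m × Fin m) (𝕜 := ℂ)
        (Matrix.of fun p q => ∑ t, A t p.1 q.1 * conj (A t p.2 q.2))‖ *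
      √(minTensorNorm x fun t => conjOp (x t)) := by
  set M := Matrix.toEuclideanCLM (n := Fin m × Fin m) (𝕜 := ℂ)
        (Matrix.of fun p q => ∑ t, A t p.1 q.1 * conj (A t p.2 q.2))
  refine norm_matrixOp_le _ (by positivity) fun ξ η => ?_
  obtain ⟨s, b, e, hs, hb, he, he1, hsum, hξ⟩ := exists_svd_tuple ξ
  obtain ⟨r, a, d, hr, ha, hd, hd1, hrsum, hη⟩ := exists_svd_tuple η
  rw [← hsum, ← hrsum]
  -- In singular bases the coefficient is ∑ r_l s_k α_t(l,k) β_t(l,k). Splitting each weight r_l s_k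
  -- evenly between α and β, Cauchy-Schwarz leaves two weighted square sums, which are matrix
  -- coefficients of ∑ a_t ⊗ ā_t and ∑ x_t ⊗ x̄_t.
  let α : Fin n → Fin m → Fin m → ℂ := fun t l k => ∑ i, ∑ j, A t i j * conj (a l i) * b k j
  let β : Fin n → Fin m → Fin m → ℂ := fun t l k => inner ℂ (d l) (x t (e k))
  have hα : ∑ l, ∑ k, r l * s k * ∑ t, ‖α t l k‖ ^ 2 ≤
      ‖M‖ * (√(∑ l, r l ^ 2) * √(∑ k, s k ^ 2)) := by
    have horth : ∀ b : Fin m → Fin m → ℂ,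
        (∀ k l, ∑ j, conj (b k j) * b l j = if k = l then 1 else 0) →
        (Pairwise fun k l => inner ℂ
          (WithLp.toLp 2 fun q : Fin m × Fin m => b k q.1 * conj (b k q.2))
          (WithLp.toLp 2 fun q : Fin m × Fin m => b l q.1 * conj (b l q.2)) = 0) ∧
        ∀ k, ‖(WithLp.toLp 2 fun q : Fin m × Fin m => b k q.1 * conj (b k q.2) :
          EuclideanSpace ℂ (Fin m × Fin m))‖ ≤ 1 := fun b hb => by
      refine ⟨fun k l hkl => ?_, fun k => ?_⟩
      · beta_reduce
        rw [inner_toLp_mul_conj, hb, if_neg hkl]; simp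
      · rw [norm_eq_sqrt_re_inner (𝕜 := ℂ), inner_toLp_mul_conj, hb, if_pos rfl]; simp
    exact sum_mul_le_opNorm_of_orthogonal M (horth b hb).1 (horth b hb).2 (horth a ha).1
      (horth a ha).2 s r _ fun l k => inner_toEuclideanCLM_toLp_mul_conj A (a l) (b k)
  have hβ : ∑ l, ∑ k, r l * s k * ∑ t, ‖β t l k‖ ^ 2 ≤
      minTensorNorm x (fun t => conjOp (x t)) * (√(∑ l, r l ^ 2) * √(∑ k, s k ^ 2)) := by
    have horth : ∀ e : Fin m → K, (Pairwise fun k l => inner ℂ (e k) (e l) = 0) →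
        (∀ k, ‖e k‖ ≤ 1) →
        (Pairwise fun k l => inner ℂ (e k ⊗ₜ[ℂ] ConjSpace.of (e k))
          (e l ⊗ₜ[ℂ] ConjSpace.of (e l)) = 0) ∧
        ∀ k, ‖e k ⊗ₜ[ℂ] ConjSpace.of (e k)‖ ≤ 1 := fun e he he1 => by
      refine ⟨fun k l hkl => ?_, fun k => ?_⟩
      · beta_reduce
        rw [TensorProduct.inner_tmul, he hkl, zero_mul]
      · rw [TensorProduct.norm_tmul]
        exact mul_le_one₀ (he1 k) (norm_nonneg _) (he1 k)
    refine sum_mul_le_opNorm_of_orthogonal (∑ t, TensorProduct.mapL (x t) (conjOp (x t)))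
      (horth e he he1).1 (horth e he he1).2 (horth d hd hd1).1
      (horth d hd hd1).2 s r _ fun l k => ?_
    simp only [sum_apply, inner_sum, TensorProduct.mapL_tmul, TensorProduct.inner_tmul,
      ConjSpace.inner_of_conjOp, Complex.ofReal_sum]
    refine Finset.sum_congr rfl fun t _ => ?_
    rw [Complex.ofReal_pow]
    exact Complex.mul_conj' _
  have hsplit : ∑ i, ∑ j, inner ℂ (η i) ((Matrix.of fun i j => ∑ t, A t i j • x t) i j (ξ j)) =
      ∑ q : Fin m × Fin m × Fin n, ((r q.1 * s q.2.1 : ℝ) : ℂ) *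
        (α q.2.2 q.1 q.2.1 * β q.2.2 q.1 q.2.1) := by
    have h : ∀ i j, inner ℂ (η i) ((Matrix.of fun i j => ∑ t, A t i j • x t) i j (ξ j)) =
        ∑ q : Fin m × Fin m × Fin n, ((r q.1 * s q.2.1 : ℝ) : ℂ) *
          (A q.2.2 i j * conj (a q.1 i) * b q.2.1 j * β q.2.2 q.1 q.2.1) := fun i j => by
      rw [hη i, hξ j]
      simp only [Matrix.of_apply, sum_apply, smul_apply, map_sum, map_smul, sum_inner, inner_sum,
        inner_smul_left, inner_smul_right, Fintype.sum_prod_type, Finset.smul_sum, Finset.mul_sum]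
      conv_rhs => rw [Finset.sum_comm]
      refine Finset.sum_congr rfl fun k _ => ?_
      conv_rhs => rw [Finset.sum_comm]
      refine Finset.sum_congr rfl fun t _ => Finset.sum_congr rfl fun l _ => ?_
      simp only [β, map_mul, Complex.conj_ofReal, Complex.ofReal_mul]
      ring
    simp only [h, α]
    rw [← Fintype.sum_prod_type' (f := fun i j => ∑ q : Fin m × Fin m × Fin n, _),
      Finset.sum_comm]
    refine Finset.sum_congr rfl fun q _ => ?_
    rw [← Finset.mul_sum, ← Finset.sum_mul, Fintype.sum_prod_type]
  rw [hsplit]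
  have hα' : ∑ q : Fin m × Fin m × Fin n, (√(r q.1 * s q.2.1) * ‖α q.2.2 q.1 q.2.1‖) ^ 2 ≤
      ‖M‖ * (√(∑ l, r l ^ 2) * √(∑ k, s k ^ 2)) := by
    refine le_trans (le_of_eq ?_) hα
    simp only [Fintype.sum_prod_type, Finset.mul_sum, mul_pow,
      Real.sq_sqrt (mul_nonneg (hr _) (hs _))]
  have hβ' : ∑ q : Fin m × Fin m × Fin n, (√(r q.1 * s q.2.1) * ‖β q.2.2 q.1 q.2.1‖) ^ 2 ≤
      minTensorNorm x (fun t => conjOp (x t)) * (√(∑ l, r l ^ 2) * √(∑ k, s k ^ 2)) := by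
    refine le_trans (le_of_eq ?_) hβ
    simp only [Fintype.sum_prod_type, Finset.mul_sum, mul_pow,
      Real.sq_sqrt (mul_nonneg (hr _) (hs _))]
  calc _ ≤ ∑ q : Fin m × Fin m × Fin n, (√(r q.1 * s q.2.1) * ‖α q.2.2 q.1 q.2.1‖) *
        (√(r q.1 * s q.2.1) * ‖β q.2.2 q.1 q.2.1‖) := by
        refine (norm_sum_le _ _).trans (Finset.sum_le_sum fun q _ => le_of_eq ?_)
        have h0 := mul_nonneg (hr q.1) (hs q.2.1)
        rw [norm_mul, norm_mul, Complex.norm_real, Real.norm_of_nonneg h0,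
          mul_mul_mul_comm (√_), Real.mul_self_sqrt h0]
    _ ≤ √(∑ q : Fin m × Fin m × Fin n, (√(r q.1 * s q.2.1) * ‖α q.2.2 q.1 q.2.1‖) ^ 2) *
        √(∑ q : Fin m × Fin m × Fin n, (√(r q.1 * s q.2.1) * ‖β q.2.2 q.1 q.2.1‖) ^ 2) :=
        Real.sum_mul_le_sqrt_mul_sqrt _ _ _
    _ ≤ √(‖M‖ * (√(∑ l, r l ^ 2) * √(∑ k, s k ^ 2))) *
        √(minTensorNorm x (fun t => conjOp (x t)) * (√(∑ l, r l ^ 2) * √(∑ k, s k ^ 2))) := by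
        gcongr
    _ = _ := by
        rw [Real.sqrt_mul (norm_nonneg _), Real.sqrt_mul (minTensorNorm_nonneg _ _),
          mul_mul_mul_comm, Real.mul_self_sqrt (by positivity)]
        ring

end

/-! ### Determinant maximization. -/

section

open scoped Matrix Matrix.Norms.L2Operator MatrixOrder ComplexOrder

variable {W : Type*} [NormedAddCommGroup W] [NormedSpace ℂ W]

/-- A maximizes |det| on the set ‖Φ(A*A)‖ ≤ 1. This set is compact because Φ is injective on a
finite-dimensional space and ‖A‖² = ‖A*A‖. Comparing A with a rescaled BA gives the inequality; the
exponents reflect that |det| has degree n and the constraint degree 2. -/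
theorem exists_maximal_det {n : ℕ} [NeZero n] (Φ : Matrix (Fin n) (Fin n) ℂ →ₗ[ℂ] W)
    (hΦ : Function.Injective Φ) :
    ∃ A : Matrix (Fin n) (Fin n) ℂ, A.det ≠ 0 ∧ ‖Φ (Aᴴ * A)‖ ≤ 1 ∧
      ∀ B : Matrix (Fin n) (Fin n) ℂ, ‖B.det‖ ^ 2 ≤ ‖Φ (Aᴴ * (Bᴴ * B) * A)‖ ^ n := by
  have hcont : Continuous fun A : Matrix (Fin n) (Fin n) ℂ => ‖Φ (Aᴴ * A)‖ :=
    (Φ.continuous_of_finiteDimensional.comp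
      (continuous_id.matrix_conjTranspose.matrix_mul continuous_id)).norm
  obtain ⟨k, hk, hanti⟩ := LinearMap.exists_antilipschitzWith Φ (LinearMap.ker_eq_bot.mpr hΦ)
  have hbound : ∀ M, ‖M‖ ≤ k * ‖Φ M‖ := fun M => by
    simpa using hanti.le_mul_dist M 0
  let S : Set (Matrix (Fin n) (Fin n) ℂ) := {A | ‖Φ (Aᴴ * A)‖ ≤ 1}
  have hscale : ∀ (c : ℝ) (B : Matrix (Fin n) (Fin n) ℂ),
      ‖Φ (((c : ℂ) • B)ᴴ * ((c : ℂ) • B))‖ = c ^ 2 * ‖Φ (Bᴴ * B)‖ := fun c B => by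
    rw [Matrix.conjTranspose_smul, Matrix.smul_mul, Matrix.mul_smul, smul_smul, map_smul,
      norm_smul]
    simp [pow_two]
  have hmem : ∀ B : Matrix (Fin n) (Fin n) ℂ, 0 < ‖Φ (Bᴴ * B)‖ →
      (((√‖Φ (Bᴴ * B)‖)⁻¹ : ℝ) : ℂ) • B ∈ S := fun B hB => by
    change ‖_‖ ≤ 1
    rw [hscale, inv_pow, Real.sq_sqrt hB.le, inv_mul_cancel₀ hB.ne']
  have hpos : ∀ B : Matrix (Fin n) (Fin n) ℂ, B.det ≠ 0 → 0 < ‖Φ (Bᴴ * B)‖ := fun B hB => by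
    rw [norm_pos_iff, Ne, map_eq_zero_iff Φ hΦ, Matrix.conjTranspose_mul_self_eq_zero]
    rintro rfl
    exact hB Matrix.det_zero
  have hcpt : IsCompact S := by
    have : ProperSpace (Matrix (Fin n) (Fin n) ℂ) := FiniteDimensional.proper ℂ _
    refine Metric.isCompact_of_isClosed_isBounded (isClosed_le hcont continuous_const) ?_
    refine (Metric.isBounded_iff_subset_closedBall 0).mpr ⟨√k, fun A hA => ?_⟩
    rw [mem_closedBall_zero_iff]
    refine Real.le_sqrt_of_sq_le ?_
    rw [pow_two, ← Matrix.l2_opNorm_conjTranspose_mul_self]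
    exact (hbound _).trans (mul_le_of_le_one_right k.2 hA)
  obtain ⟨A, hA, hmax⟩ := hcpt.exists_isMaxOn ⟨0, by simp [S]⟩
    (f := fun A : Matrix (Fin n) (Fin n) ℂ => ‖A.det‖) (continuous_id.matrix_det.norm.continuousOn)
  have hdet : A.det ≠ 0 := by
    -- A nonzero multiple of the identity is admissible, so the maximum is positive.
    have h1 := hpos 1 (by simp)
    have h2 : ‖_‖ ≤ ‖A.det‖ := hmax (hmem 1 h1)
    rw [← norm_pos_iff]
    refine lt_of_lt_of_le ?_ h2
    rw [Matrix.det_smul, norm_pos_iff]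
    have := (Real.sqrt_pos.mpr h1).ne'
    rw [Matrix.det_one, mul_one]
    exact pow_ne_zero _ (Complex.ofReal_ne_zero.mpr (inv_ne_zero this))
  refine ⟨A, hdet, hA, fun B => ?_⟩
  by_cases hB : B.det = 0
  · rw [hB, norm_zero, zero_pow two_ne_zero]
    exact pow_nonneg (norm_nonneg _) n
  have hp := hpos (B * A) (by simp [hB, hdet])
  have he : Aᴴ * (Bᴴ * B) * A = (B * A)ᴴ * (B * A) := by
    simp [Matrix.mul_assoc]
  rw [he]
  have h2 : ‖_‖ ≤ ‖A.det‖ := hmax (hmem _ hp)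
  rw [Matrix.det_smul, Matrix.det_mul, norm_mul, norm_mul, ← mul_assoc] at h2
  have h3 := le_of_mul_le_mul_right (h2.trans (one_mul _).ge) (norm_pos_iff.mpr hdet)
  rw [norm_pow, Complex.norm_real, Fintype.card_fin, Real.norm_of_nonneg (by positivity), inv_pow,
    inv_mul_le_one₀ (by positivity)] at h3
  calc ‖B.det‖ ^ 2 ≤ (√‖Φ ((B * A)ᴴ * (B * A))‖ ^ n) ^ 2 := by gcongr
    _ = _ := by rw [← pow_mul, mul_comm, pow_mul, Real.sq_sqrt hp.le]

/-- A trace inequality of John type at a maximum of the determinant. -/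
theorem exists_trace_le {n : ℕ} [NeZero n] (Φ : Matrix (Fin n) (Fin n) ℂ →ₗ[ℂ] W)
    (hΦ : Function.Injective Φ) :
    ∃ A : Matrix (Fin n) (Fin n) ℂ, A.det ≠ 0 ∧ ‖Φ (Aᴴ * A)‖ ≤ 1 ∧
      ∀ Q : Matrix (Fin n) (Fin n) ℂ, Q.PosSemidef →
        Q.trace.re ≤ n * ‖Φ (Aᴴ * Q * A)‖ := by
  obtain ⟨A, hdet, hA, h⟩ := exists_maximal_det Φ hΦ
  refine ⟨A, hdet, hA, fun Q hQ => ?_⟩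
  set q := ‖Φ (Aᴴ * Q * A)‖
  -- P is the remainder in det(1 + εQ) = 1 + ε tr Q + ε² P(ε).
  let P := (Matrix.det (1 + (Polynomial.X : Polynomial ℂ) • Q.map Polynomial.C)).divX.divX
  let f : ℝ → ℝ := fun ε => (1 + ε * q) ^ n - (1 + Q.trace * ε + P.eval (ε : ℂ) * ε ^ 2).re
  have hf : ∀ ε : ℝ, 0 ≤ ε → 0 ≤ f ε := fun ε hε => by
    have hpsd : (1 + (ε : ℂ) • Q).PosSemidef :=
      Matrix.PosSemidef.one.add (hQ.smul (by exact_mod_cast hε))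
    obtain ⟨B, hB : _ = Bᴴ * B⟩ :=
      CStarAlgebra.nonneg_iff_eq_star_mul_self.mp hpsd.nonneg
    have h1 := h B
    have h2 : ‖B.det‖ ^ 2 = (1 + Q.trace * ε + P.eval (ε : ℂ) * ε ^ 2).re := by
      rw [← Matrix.det_one_add_smul, hB, Matrix.det_mul, Matrix.det_conjTranspose]
      have := Complex.conj_mul' B.det
      rw [← starRingEnd_apply, this, ← Complex.ofReal_pow, Complex.ofReal_re]
    have h3 : ‖Φ (Aᴴ * (Bᴴ * B) * A)‖ ≤ 1 + ε * q := by
      rw [← hB, Matrix.mul_add, Matrix.add_mul, Matrix.mul_one, Matrix.mul_smul, Matrix.smul_mul,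
        map_add, map_smul]
      refine (norm_add_le _ _).trans (add_le_add hA ?_)
      rw [norm_smul, Complex.norm_real, Real.norm_of_nonneg hε]
    have h4 : ‖Φ (Aᴴ * (Bᴴ * B) * A)‖ ^ n ≤ (1 + ε * q) ^ n := by gcongr
    simp only [f, ← h2]
    linarith
  have hf0 : f 0 = 0 := by simp [f]
  have hder : HasDerivAt f (n * q - Q.trace.re) 0 := by
    have h1 : HasDerivAt (fun ε : ℝ => (1 + ε * q) ^ n) (n * q) 0 := by
      have := (((hasDerivAt_id (0 : ℝ)).mul_const q).const_add 1).pow n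
      exact this.congr_deriv (by simp)
    have h2 : HasDerivAt (fun z : ℂ => 1 + Q.trace * z + P.eval z * z ^ 2) Q.trace ((0 : ℝ) : ℂ) := by
      have := (((hasDerivAt_id ((0 : ℝ) : ℂ)).const_mul Q.trace).const_add 1).add
        ((P.hasDerivAt ((0 : ℝ) : ℂ)).mul ((hasDerivAt_id ((0 : ℝ) : ℂ)).pow 2))
      exact this.congr_deriv (by simp)
    exact h1.sub h2.real_of_complex
  -- Since f ≥ 0 for ε ≥ 0 and f(0) = 0, the derivative n q − Re tr Q at 0 is nonnegative.
  have hlim := hder.tendsto_slope_zero_right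
  have : 0 ≤ n * q - Q.trace.re := by
    refine ge_of_tendsto hlim ?_
    filter_upwards [self_mem_nhdsWithin] with t ht
    rw [zero_add, hf0, sub_zero, smul_eq_mul]
    exact mul_nonneg (inv_nonneg.mpr (le_of_lt ht)) (hf t (le_of_lt ht))
  linarith

end

/-! ### The extremal basis of a finite-dimensional operator space. -/

section

variable {H : Type u} [NormedAddCommGroup H] [InnerProductSpace ℂ H]
variable {K : Type v} [NormedAddCommGroup K] [InnerProductSpace ℂ K]

open scoped Matrix ComplexOrder

/-- The operator `∑ P_{st} g_t ⊗ conj g_s` attached to a matrix `P` and a tuple `g` of operators. -/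
noncomputable def tensorForm {n : ℕ} (g : Fin n → K →L[ℂ] K) :
    Matrix (Fin n) (Fin n) ℂ →ₗ[ℂ] (K ⊗[ℂ] ConjSpace K →L[ℂ] K ⊗[ℂ] ConjSpace K) :=
  ∑ s, ∑ t, (Matrix.entryLinearMap ℂ ℂ s t).smulRight (TensorProduct.mapL (g t) (conjOp (g s)))

theorem tensorForm_apply {n : ℕ} (g : Fin n → K →L[ℂ] K) (P : Matrix (Fin n) (Fin n) ℂ) :
    tensorForm g P = ∑ s, ∑ t, P s t • TensorProduct.mapL (g t) (conjOp (g s)) := by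
  simp [tensorForm]

/-- Testing the second leg against vectors and using independence of g in the first leg removes the
sum over t; conjugating and using independence again removes the sum over s. -/
theorem tensorForm_injective {n : ℕ} {g : Fin n → K →L[ℂ] K} (hg : LinearIndependent ℂ g) :
    Function.Injective (tensorForm g) := by
  rw [injective_iff_map_eq_zero]
  intro P hP
  rw [tensorForm_apply] at hP
  have hli := Fintype.linearIndependent_iff.mp hg
  have h1 : ∀ κ κ' : K, ∀ t, ∑ s, P s t * conj (inner ℂ κ' (g s κ)) = 0 := by
    intro κ κ'
    refine hli _ ?_
    ext ξ
    refine ext_inner_left ℂ fun ξ' => ?_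
    have h := congrArg (fun S => inner ℂ (ξ' ⊗ₜ[ℂ] ConjSpace.of κ') (S (ξ ⊗ₜ[ℂ] ConjSpace.of κ))) hP
    simp only [sum_apply, smul_apply, inner_sum, inner_smul_right, TensorProduct.mapL_tmul,
      TensorProduct.smul_tmul', TensorProduct.inner_tmul, ConjSpace.inner_of_conjOp, zero_apply,
      inner_zero_right] at h
    simp only [sum_apply, smul_apply, inner_sum, inner_smul_right, zero_apply, inner_zero_right,
      Finset.sum_mul]
    rw [Finset.sum_comm, ← h]
    refine Finset.sum_congr rfl fun s _ => Finset.sum_congr rfl fun t _ => ?_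
    simp only [ConjSpace.un, ConjSpace.of]
    ring
  ext s t
  have h2 : ∑ s, conj (P s t) • g s = 0 := by
    ext κ
    refine ext_inner_left ℂ fun κ' => ?_
    have h := congrArg conj (h1 κ κ' t)
    simpa [inner_sum, inner_smul_right] using h
  simpa using hli _ h2 s

/-- With y_i = ∑ c_{it} g_t, the coefficient of g_t ⊗ ḡ_s in ∑ y_i ⊗ ȳ_i is ∑ conj(c_{is}) c_{it} =
(c*c)_{st}, whence the index order in `tensorForm`. -/
theorem norm_tensorForm_conjTranspose_mul_self {n m : ℕ} (g : Fin n → K →L[ℂ] K)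
    (c : Matrix (Fin m) (Fin n) ℂ) :
    ‖tensorForm g (cᴴ * c)‖ =
      minTensorNorm (fun i => ∑ t, c i t • g t) (fun i => conjOp (∑ t, c i t • g t)) := by
  rw [tensorForm_apply, minTensorNorm]
  congr 1
  refine ContinuousLinearMap.coe_injective (TensorProduct.ext' fun ξ κ => ?_)
  have hc : ∀ (i : Fin m), conjOp (∑ t, c i t • g t) = ∑ t, conj (c i t) • conjOp (g t) := by
    intro i
    let J : (K →L[ℂ] K) →ₛₗ[starRingEnd ℂ] (ConjSpace K →L[ℂ] ConjSpace K) :=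
      { toFun := conjOp, map_add' := conjOp_add, map_smul' := conjOp_smul }
    have := map_sum J (fun t => c i t • g t) Finset.univ
    simp only [map_smulₛₗ] at this
    exact this
  simp only [ContinuousLinearMap.coe_coe, sum_apply, smul_apply, TensorProduct.mapL_tmul, hc,
    TensorProduct.tmul_sum, TensorProduct.sum_tmul, Matrix.mul_apply, Finset.sum_smul,
    TensorProduct.smul_tmul', TensorProduct.tmul_smul, Matrix.conjTranspose_apply]
  rw [Finset.sum_congr rfl fun s _ => Finset.sum_comm, Finset.sum_comm]
  refine Finset.sum_congr rfl fun i _ => Finset.sum_congr rfl fun s _ => ?_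
  rw [Finset.smul_sum]
  refine Finset.sum_congr rfl fun t _ => ?_
  rw [TensorProduct.smul_tmul', smul_smul, starRingEnd_apply]

/-- Every finite-dimensional operator space has a basis `x` with `‖∑ x_t ⊗ x̄_t‖ ≤ 1` whose
coordinate map to `OH_n` has `(2, oh)`-summing norm at most `√n`. -/
theorem exists_basis_coord_sum_le {G : Type*} [AddCommGroup G] [Module ℂ G]
    {n : ℕ} [NeZero n] (g : Module.Basis (Fin n) ℂ G) (j : G →ₗ[ℂ] (K →L[ℂ] K))
    (hj : Function.Injective j) :
    ∃ x : Module.Basis (Fin n) ℂ G,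
      minTensorNorm (fun t => j (x t)) (fun t => conjOp (j (x t))) ≤ 1 ∧
      ∀ (m : ℕ) (y : Fin m → G), ∑ i, ∑ t, ‖x.repr (y i) t‖ ^ 2 ≤
        n * minTensorNorm (fun i => j (y i)) (fun i => conjOp (j (y i))) := by
  have hli : LinearIndependent ℂ (fun t => j (g t)) :=
    g.linearIndependent.map' j (LinearMap.ker_eq_bot.mpr hj)
  obtain ⟨A, hdet, hA, h⟩ := exists_trace_le
    (W := K ⊗[ℂ] ConjSpace K →L[ℂ] K ⊗[ℂ] ConjSpace K) (tensorForm fun t => j (g t))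
    (tensorForm_injective hli)
  let L : G ≃ₗ[ℂ] G := Matrix.toLinearEquiv g Aᵀ (by
    rw [Matrix.det_transpose]; exact isUnit_iff_ne_zero.mpr hdet)
  let x := g.map L
  have hx : ∀ t, x t = ∑ s, A t s • g s := fun t => by
    simp [x, L, Matrix.toLinearEquiv, Matrix.toLin_self]
  refine ⟨x, ?_, fun m y => ?_⟩
  · rw [norm_tensorForm_conjTranspose_mul_self] at hA
    simpa [hx] using hA
  · let c : Matrix (Fin m) (Fin n) ℂ := Matrix.of fun i t => x.repr (y i) t
    -- The trace of c*c is the sum of the squared coordinates, and cA holds the coordinates of the y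
    -- i in the basis g.
    have h1 := h (cᴴ * c) (Matrix.posSemidef_conjTranspose_mul_self c)
    have h2 : Aᴴ * (cᴴ * c) * A = (c * A)ᴴ * (c * A) := by simp [Matrix.mul_assoc]
    have hy : ∀ i, ∑ s, (c * A) i s • j (g s) = j (y i) := fun i => by
      conv_rhs => rw [← x.sum_repr (y i)]
      simp only [hx, Matrix.mul_apply, Finset.sum_smul, map_sum, map_smul, Finset.smul_sum,
        smul_smul]
      exact Finset.sum_comm
    rw [h2, norm_tensorForm_conjTranspose_mul_self] at h1
    simp only [hy] at h1
    refine le_trans (le_of_eq ?_) h1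
    simp only [Matrix.trace, Matrix.diag, Matrix.mul_apply, Complex.re_sum]
    rw [Finset.sum_comm]
    refine Finset.sum_congr rfl fun t _ => Finset.sum_congr rfl fun i _ => ?_
    rw [Matrix.conjTranspose_apply, ← starRingEnd_apply, Complex.conj_mul', ← Complex.ofReal_pow,
      Complex.ofReal_re]
    rfl

/-! ### The completely bounded norm as a bound, and maps out of OH. -/

theorem cbNorm_zero {V W : Type*} [AddCommGroup V] [Module ℂ V] [AddCommGroup W] [Module ℂ W]
    (p : ∀ n : ℕ, Matrix (Fin n) (Fin n) V → ℝ) (q : ∀ n : ℕ, Matrix (Fin n) (Fin n) W → ℝ)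
    (hq : ∀ n, q n 0 = 0) : cbNorm p q (0 : V →ₗ[ℂ] W) = 0 := by
  have h : ∀ n (x : Matrix (Fin n) (Fin n) V), x.map (0 : V →ₗ[ℂ] W) = 0 := fun n x => by
    ext; simp
  simp [cbNorm, h, hq]

theorem opMatNorm_nonneg (E : Submodule ℂ (H →L[ℂ] H)) (n : ℕ) (X : Matrix (Fin n) (Fin n) E) :
    0 ≤ opMatNorm E n X := ContinuousLinearMap.opNorm_nonneg _

theorem opMatNorm_zero (E : Submodule ℂ (H →L[ℂ] H)) (n : ℕ) : opMatNorm E n 0 = 0 := by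
  refine le_antisymm (norm_matrixOp_le _ le_rfl fun ξ η => ?_) (opMatNorm_nonneg _ _ _)
  simp

theorem opMatNorm_smul_le (E : Submodule ℂ (H →L[ℂ] H)) (n : ℕ) {r : ℝ} (hr : 0 ≤ r)
    (X : Matrix (Fin n) (Fin n) E) : opMatNorm E n ((r : ℂ) • X) ≤ r * opMatNorm E n X := by
  refine norm_matrixOp_le _ (mul_nonneg hr (opMatNorm_nonneg _ _ _)) fun ξ η => ?_
  have h := norm_sum_inner_le (X.map fun e => (e : H →L[ℂ] H)) ξ η
  have e : ∑ i, ∑ j, inner ℂ (η i) ((((r : ℂ) • X).map fun e => (e : H →L[ℂ] H)) i j (ξ j)) =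
      (r : ℂ) * ∑ i, ∑ j, inner ℂ (η i) ((X.map fun e => (e : H →L[ℂ] H)) i j (ξ j)) := by
    simp [Finset.mul_sum]
  rw [e, norm_mul, Complex.norm_real, Real.norm_of_nonneg hr, mul_assoc, mul_assoc]
  rw [mul_assoc] at h
  exact mul_le_mul_of_nonneg_left h hr

theorem opMatNorm_smul (E : Submodule ℂ (H →L[ℂ] H)) (n : ℕ) {r : ℝ} (hr : 0 ≤ r)
    (X : Matrix (Fin n) (Fin n) E) : opMatNorm E n ((r : ℂ) • X) = r * opMatNorm E n X := by
  refine le_antisymm (opMatNorm_smul_le E n hr X) ?_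
  rcases hr.eq_or_lt with rfl | h
  · rw [zero_mul]; exact opMatNorm_nonneg _ _ _
  · have h1 := opMatNorm_smul_le E n (inv_nonneg.mpr hr) ((r : ℂ) • X)
    rw [smul_smul, ← Complex.ofReal_mul, inv_mul_cancel₀ h.ne', Complex.ofReal_one, one_smul,
      le_inv_mul_iff₀ h] at h1
    exact h1

theorem opMatNorm_map_le {E : Submodule ℂ (H →L[ℂ] H)} {F : Submodule ℂ (K →L[ℂ] K)}
    (T : E →ₗ[ℂ] F) (hT : cbNorm (opMatNorm E) (opMatNorm F) T ≠ ⊤) (n : ℕ)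
    (X : Matrix (Fin n) (Fin n) E) :
    opMatNorm F n (X.map T) ≤
      (cbNorm (opMatNorm E) (opMatNorm F) T).toReal * opMatNorm E n X := by
  set c := (cbNorm (opMatNorm E) (opMatNorm F) T).toReal with hc
  have hunit : ∀ Y : Matrix (Fin n) (Fin n) E, opMatNorm E n Y ≤ 1 →
      opMatNorm F n (Y.map T) ≤ c := fun Y hY => by
    have : ENNReal.ofReal (opMatNorm F n (Y.map T)) ≤ cbNorm (opMatNorm E) (opMatNorm F) T :=
      le_iSup₂_of_le n Y (le_iSup_of_le hY le_rfl)
    exact (ENNReal.ofReal_le_iff_le_toReal hT).mp this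
  have hscale : ∀ r : ℝ, 0 ≤ r → r * opMatNorm E n X ≤ 1 →
      r * opMatNorm F n (X.map T) ≤ c := fun r hr h => by
    rw [← opMatNorm_smul _ _ hr] at h ⊢
    refine le_trans (le_of_eq ?_) (hunit _ h)
    congr 1
    ext i j : 1
    simp
  have h0 : 0 ≤ opMatNorm E n X := opMatNorm_nonneg _ _ _
  rcases h0.eq_or_lt with h0 | h0
  · rw [← h0, mul_zero]
    by_contra! hlt
    -- Every multiple of X lies in the unit ball, so a nonzero image could be scaled to norm c + 1,
    -- beyond the bound c.
    have h := hscale ((c + 1) / opMatNorm F n (X.map T))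
      (div_nonneg (add_nonneg ENNReal.toReal_nonneg zero_le_one) hlt.le) (by rw [← h0]; simp)
    rw [div_mul_cancel₀ _ hlt.ne'] at h
    linarith
  · have h := hscale (opMatNorm E n X)⁻¹ (inv_nonneg.mpr h0.le) (inv_mul_cancel₀ h0.ne').le
    rwa [inv_mul_le_iff₀ h0, mul_comm] at h

/-- The map `OH(I) → F` sending the canonical basis to `x` is completely contractive when
`‖∑ x_t ⊗ x̄_t‖ ≤ 1`. -/
theorem cbNorm_ohMatNorm_le_one {n : ℕ} (F : Submodule ℂ (K →L[ℂ] K)) (x : Fin n → F)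
    (hx : minTensorNorm (fun t => (x t : K →L[ℂ] K)) (fun t => conjOp (x t : K →L[ℂ] K)) ≤ 1)
    (b : OH (ULift.{w} (Fin n)) →ₗ[ℂ] F) (hb : ∀ f, b f = ∑ t, f ⟨t⟩ • x t) :
    cbNorm (ohMatNorm (ULift.{w} (Fin n))) (opMatNorm F) b ≤ 1 := by
  refine iSup_le fun m => iSup_le fun X => iSup_le fun hX => ?_
  rw [← ENNReal.ofReal_one]
  refine ENNReal.ofReal_le_ofReal ?_
  let A : Fin n → Matrix (Fin m) (Fin m) ℂ := fun t => Matrix.of fun i j => X i j ⟨t⟩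
  have h := norm_matrixOp_sum_smul_le A (fun t => (x t : K →L[ℂ] K))
  have e1 : opMatNorm F m (X.map b) =
      ‖matrixOp (Matrix.of fun i j => ∑ t, A t i j • (x t : K →L[ℂ] K))‖ := by
    rw [opMatNorm]
    congr 2
    ext i j : 1
    simp [hb, A]
  have e2 : ohMatNorm (ULift.{w} (Fin n)) m X =
      √‖Matrix.toEuclideanCLM (n := Fin m × Fin m) (𝕜 := ℂ)
        (Matrix.of fun p q => ∑ t, A t p.1 q.1 * conj (A t p.2 q.2))‖ := by
    rw [ohMatNorm]
    congr 4
    ext p q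
    change inner ℂ (X p.2 q.2) (X p.1 q.1) =
      ∑ t : Fin n, X p.1 q.1 ⟨t⟩ * conj (X p.2 q.2 ⟨t⟩)
    rw [lp.inner_eq_tsum, tsum_fintype,
      ← Equiv.ulift.symm.sum_comp]
    simp
  rw [e1]
  refine h.trans ?_
  rw [← e2]
  exact mul_le_one₀ hX (Real.sqrt_nonneg _) (Real.sqrt_le_one.mpr hx)

end

/-! ### The factorization through OH_n. -/

theorem mainTheorem5
    {H : Type u} [NormedAddCommGroup H] [InnerProductSpace ℂ H] [CompleteSpace H]
    {K : Type v} [NormedAddCommGroup K] [InnerProductSpace ℂ K] [CompleteSpace K]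
    (E : Submodule ℂ (H →L[ℂ] H)) (F : Submodule ℂ (K →L[ℂ] K))
    (T : E →ₗ[ℂ] F) (hT : FiniteDimensional ℂ (LinearMap.range T)) :
    delta.{u, v, w} E F T ≤
      cbNorm (opMatNorm E) (opMatNorm F) T *
        ENNReal.ofReal (√(Module.finrank ℂ (LinearMap.range T) : ℝ)) := by
  set n := Module.finrank ℂ (LinearMap.range T) with hn
  rcases Nat.eq_zero_or_pos n with h0 | hpos
  · have hT0 : T = 0 := LinearMap.range_eq_bot.mp (Submodule.finrank_eq_zero.mp (hn ▸ h0))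
    -- In rank zero both factors are taken to be 0; the product vanishes because ‖0‖_cb = 0 and 0 ·
    -- ∞ = 0 in [0, ∞].
    refine le_trans (iInf_le_of_le PUnit (iInf₂_le_of_le 0 0 (iInf_le_of_le ?_ le_rfl))) ?_
    · rw [hT0, LinearMap.comp_zero]
    · rw [cbNorm_zero _ _ (opMatNorm_zero F), zero_mul]
      exact zero_le
  have : NeZero n := ⟨hpos.ne'⟩
  by_cases htop : cbNorm (opMatNorm E) (opMatNorm F) T = ⊤
  · rw [htop, ENNReal.top_mul]
    · exact le_top
    · simpa using hpos
  let G : Submodule ℂ (K →L[ℂ] K) := (LinearMap.range T).map F.subtype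
  have hGF : ∀ y : G, (y : K →L[ℂ] K) ∈ F := fun y => Submodule.map_subtype_le _ _ y.2
  let e : LinearMap.range T ≃ₗ[ℂ] G := Submodule.equivSubtypeMap F (LinearMap.range T)
  have : FiniteDimensional ℂ G := Module.Finite.equiv e
  have hnG : Module.finrank ℂ G = n := e.finrank_eq.symm
  obtain ⟨x, hx1, hx⟩ := exists_basis_coord_sum_le (Module.finBasisOfFinrankEq ℂ G hnG)
    G.subtype G.injective_subtype
  let S : E →ₗ[ℂ] G := (F.subtype ∘ₗ T).codRestrict G fun y =>
    ⟨T y, LinearMap.mem_range_self T y, rfl⟩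
  obtain ⟨X, hX⟩ : ∃ X : Fin n → F, ∀ t, (X t : K →L[ℂ] K) = x t :=
    ⟨fun t => ⟨x t, hGF (x t)⟩, fun t => rfl⟩
  -- `ULift` places the n-point index set in the universe over which δ takes its infimum.
  let u : G →ₗ[ℂ] OH (ULift.{w} (Fin n)) :=
    { toFun := fun y => ⟨fun t => x.repr y t.down, memℓp_gen (Summable.of_finite)⟩
      map_add' := fun y z => by ext t; simp; rfl
      map_smul' := fun r y => by ext t; simp }
  let b : OH (ULift.{w} (Fin n)) →ₗ[ℂ] F :=
    { toFun := fun f => ∑ t, f ⟨t⟩ • X t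
      map_add' := fun y z => by simp [add_smul, Finset.sum_add_distrib]
      map_smul' := fun r y => by simp [Finset.smul_sum, smul_smul] }
  have hu : ∀ y, ‖u y‖ ^ 2 = ∑ t, ‖x.repr y t‖ ^ 2 := fun y => by
    have := lp.norm_rpow_eq_tsum (p := 2) (by norm_num) (u y)
    rw [tsum_fintype, ← Equiv.ulift.symm.sum_comp] at this
    simpa [u] using this
  have hfac : b ∘ₗ (u ∘ₗ S) = T := by
    ext y : 2
    have h := congrArg Subtype.val (x.sum_repr (S y))
    simp only [Submodule.coe_sum, Submodule.coe_smul] at h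
    rw [show ((S y : G) : K →L[ℂ] K) = T y from rfl] at h
    simpa [b, u, hX] using h
  set c := (cbNorm (opMatNorm E) (opMatNorm F) T).toReal with hc
  have hc0 : 0 ≤ c := ENNReal.toReal_nonneg
  have hb : cbNorm (ohMatNorm (ULift.{w} (Fin n))) (opMatNorm F) b ≤ 1 :=
    cbNorm_ohMatNorm_le_one F X (by simpa [hX] using hx1) b fun f => rfl
  have ha : pi2oh E (u ∘ₗ S) ≤ ((NNReal.mk (c * √n) (by positivity) : ℝ≥0) : ℝ≥0∞) := by
    refine iInf₂_le_of_le _ (fun m y => ?_) le_rfl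
    have h1 := hx m fun i => S (y i)
    have h2 := minTensorNorm_map_conj_le T hc0 (opMatNorm_map_le T htop) y
    simp only [LinearMap.comp_apply, hu]
    refine h1.trans ?_
    calc _ ≤ (n : ℝ) * (c ^ 2 * minTensorNorm (fun i => (y i : H →L[ℂ] H))
          (fun i => conjOp (y i : H →L[ℂ] H))) := mul_le_mul_of_nonneg_left h2 (Nat.cast_nonneg _)
      _ = _ := by
        rw [NNReal.coe_mk, mul_pow, Real.sq_sqrt (Nat.cast_nonneg _)]
        ring
  refine le_trans (iInf_le_of_le (ULift.{w} (Fin n)) (iInf₂_le_of_le _ b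
    (iInf_le_of_le hfac le_rfl))) ?_
  refine (mul_le_mul' hb ha).trans ?_
  rw [one_mul, ← ENNReal.ofReal_eq_coe_nnreal, ENNReal.ofReal_mul hc0, hc,
    ENNReal.ofReal_toReal htop]
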